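/- Let $K$ be a field, $n\ge 0$, $S=K[x_1,\dots,x_n]$ with its $\mathbb Z^n$-grading, and let $I\subseteq S$ be a monomial ideal. Let $r\ge 0$, let $P_1,\dots,P_r$ be ideals of $S$ and $a_1,\dots,a_r\in\mathbb Z^n$. The following conditions are equivalent: (a) $S/I$ admits a multigraded prime filtration $(0)=M_0\subseteq M_1\subseteq\cdots\subseteq M_r=S/I$ with $M_i/M_{i-1}\cong (S/P_i)(-a_i)$ for all $i$; that is, the $M_i$ are multigraded submodules, the $P_i$ are monomial prime ideals, and the isomorphisms are isomorphisms of multigraded $S$-modules; (b) there exist a chain of monomial ideals $I=I_0\subseteq I_1\subseteq\cdots\subseteq I_r=S$ and monomials $u_i$ of multidegree $a_i$ such that $I_i=(I_{i-1},u_i)$ and $I_{i-1}:u_i=P_i$ is a prime ideal for $i=1,\dots,r$. More precisely, submodules $M_0,\dots,M_r$ of $S/I$ form a filtration as in (a) if and only if their preimages $I_0,\dots,I_r$ in $S$ (so that $M_i=I_i/I$), with suitable monomials $u_i$, form a chain as in (b). For every chain as in (b) there exist irreducible monomial ideals $J_1,\dots,J_r$ such that $I_i=\bigcap_{j=i+1}^r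 J_j$ for $i=0,\dots,r$ (the empty intersection being $S$). Suppose moreover that the prime filtration is pretty clean, that is, $P_i=P_j$ whenever $i<j$ and $P_i\subseteq P_j$. Then the set $\{J_1,\dots,J_r\}$ is uniquely determined, the ideals $J_1,\dots,J_r$ are pairwise distinct, and $b\mapsto I(\Gamma(b))$ is a bijection from the set of facets of the multicomplex $\Gamma$ associated with $I$ onto $\{J_1,\dots,J_r\}$. Here $\mathbb N_\infty=\mathbb N\cup\{\infty\}$, and $\mathbb N_\infty^n$ is ordered componentwise. A multicomplex is a subset $\Gamma\subseteq\mathbb N_\infty^n$ that contains with $a$ all $b\le a$ and that is equal to the set of all componentwise limits of ascending sequences in $\Gamma$. A facet of $\Gamma$ is an element $a\in\Gamma$ such that $\{i: a(i)=\infty\}=\{i: m(i)=\infty\}$ for every maximal element $m\ge a$ of $\Gamma$. For $A\subseteq\mathbb N_\infty^n$, $\Gamma(A)$ denotes the smallest multicomplex containing $A$, and $\Gamma(b)=\Gamma(\{b\})$. $I(\Gamma)$ is the monomial ideal spanned over $K$ by the monomials $x^e$, $e\in\mathbb N^n\setminus\Gamma$. The multicomplex associated with $I$ is $\Gamma(\{e\in\mathbb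 N^n: x^e\notin I\})$; it satisfies $I(\Gamma)=I$. An ideal is irreducible if it is proper and not the intersection of two strictly larger ideals. -/

import Mathlib

open MvPolynomial Filter Topology

namespace MultigradedFiltration

/-! ### Monomial ideals and the multigrading on `S = K[x₁, …, xₙ]` -/

section Algebra

variable {K : Type*} [Field K] {n : ℕ}

/-- A monomial ideal: an ideal generated by a set of monomials. -/
def IsMonomialIdeal (I : Ideal (MvPolynomial (Fin n) K)) : Prop :=
  ∃ A : Set (Fin n →₀ ℕ), I = Ideal.span ((fun e => monomial e (1 : K)) '' A)

/-- An irreducible monomial ideal: a monomial ideal which is proper and is not the intersection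
of two strictly larger ideals. -/
def IsIrreducibleMonomialIdeal (J : Ideal (MvPolynomial (Fin n) K)) : Prop :=
  IsMonomialIdeal J ∧ InfIrred J

/-- `f : S` is homogeneous of multidegree `d ∈ ℤⁿ`, where `xᵢ` has as multidegree the `i`-th
unit vector. -/
def IsMultihomogeneous (d : Fin n → ℤ) (f : MvPolynomial (Fin n) K) : Prop :=
  IsWeightedHomogeneous (fun i : Fin n => (Pi.single i 1 : Fin n → ℤ)) f d

/-- `x : S/I` is homogeneous of multidegree `d`, that is, `x` lies in the image of `S_d`. -/
def QuotIsMultihomogeneous (I : Ideal (MvPolynomial (Fin n) K)) (d : Fin n → ℤ)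
    (x : MvPolynomial (Fin n) K ⧸ I) : Prop :=
  ∃ f : MvPolynomial (Fin n) K, IsMultihomogeneous d f ∧ Ideal.Quotient.mk I f = x

/-- A multigraded submodule of `S/I`: one generated by its multihomogeneous elements. -/
def IsMultigradedSubmodule (I : Ideal (MvPolynomial (Fin n) K))
    (M : Submodule (MvPolynomial (Fin n) K) (MvPolynomial (Fin n) K ⧸ I)) : Prop :=
  M = Submodule.span (MvPolynomial (Fin n) K) {x | x ∈ M ∧ ∃ d, QuotIsMultihomogeneous I d x}

/-- For submodules `M' ≤ M` of `S/I`: there is an isomorphism `(S/P)(-a) ≅ M/M'` of multigraded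
`S`-modules. The component of `(S/P)(-a)` in multidegree `d` is `(S/P)_{d-a}`, and the component
of `M/M'` in multidegree `d` is the image of `M ∩ (S/I)_d`. -/
def MultigradedIsoShift (I : Ideal (MvPolynomial (Fin n) K))
    (M' M : Submodule (MvPolynomial (Fin n) K) (MvPolynomial (Fin n) K ⧸ I))
    (P : Ideal (MvPolynomial (Fin n) K)) (a : Fin n → ℤ) : Prop :=
  ∃ φ : (MvPolynomial (Fin n) K ⧸ P) ≃ₗ[MvPolynomial (Fin n) K] (M ⧸ M'.submoduleOf M),
    ∀ (d : Fin n → ℤ) (x : MvPolynomial (Fin n) K ⧸ P),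
      QuotIsMultihomogeneous P (d - a) x ↔
        ∃ m : M, QuotIsMultihomogeneous I d (m : MvPolynomial (Fin n) K ⧸ I) ∧
          (M'.submoduleOf M).mkQ m = φ x

/-- `0 = M₀ ⊆ M₁ ⊆ ⋯ ⊆ M_r = S/I` is a multigraded prime filtration with factors
`M_i/M_{i-1} ≅ (S/P_i)(-a_i)`. The lists `P₁, …, P_r` and `a₁, …, a_r` are indexed by `Fin r`,
so that for `i : Fin r` the `i`-th factor is `M i.succ / M i.castSucc`. -/
structure IsMultigradedPrimeFiltration (I : Ideal (MvPolynomial (Fin n) K)) {r : ℕ}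
    (M : Fin (r + 1) → Submodule (MvPolynomial (Fin n) K) (MvPolynomial (Fin n) K ⧸ I))
    (P : Fin r → Ideal (MvPolynomial (Fin n) K)) (a : Fin r → Fin n → ℤ) : Prop where
  mono : Monotone M
  zero : M 0 = ⊥
  last : M (Fin.last r) = ⊤
  graded : ∀ i, IsMultigradedSubmodule I (M i)
  prime : ∀ i, (P i).IsPrime
  prime_monomial : ∀ i, IsMonomialIdeal (P i)
  factor : ∀ i : Fin r, MultigradedIsoShift I (M i.castSucc) (M i.succ) (P i) (a i)

/-- A chain `I = I₀ ⊆ I₁ ⊆ ⋯ ⊆ I_r = S` of monomial ideals and monomials `u_i = x^{e_i}` of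
multidegree `a_i` with `I_i = (I_{i-1}, u_i)` and `I_{i-1} : u_i = P_i`, a prime ideal. -/
structure IsMonomialPrimeChain (I : Ideal (MvPolynomial (Fin n) K)) {r : ℕ}
    (C : Fin (r + 1) → Ideal (MvPolynomial (Fin n) K)) (e : Fin r → Fin n →₀ ℕ)
    (P : Fin r → Ideal (MvPolynomial (Fin n) K)) (a : Fin r → Fin n → ℤ) : Prop where
  mono : Monotone C
  zero : C 0 = I
  last : C (Fin.last r) = ⊤
  monomial : ∀ i, IsMonomialIdeal (C i)
  degree : ∀ i k, (e i k : ℤ) = a i k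
  succ : ∀ i : Fin r, C i.succ = C i.castSucc ⊔ Ideal.span {MvPolynomial.monomial (e i) (1 : K)}
  prime : ∀ i, (P i).IsPrime
  colon : ∀ i : Fin r, (C i.castSucc).colon {MvPolynomial.monomial (e i) (1 : K)} = P i

/-- The pretty clean condition on the list of primes `P₁, …, P_r` of a prime filtration. -/
def IsPrettyClean {r : ℕ} (P : Fin r → Ideal (MvPolynomial (Fin n) K)) : Prop :=
  ∀ i j : Fin r, i < j → P i ≤ P j → P i = P j

/-- `J₁, …, J_r` are irreducible monomial ideals with `I_i = ⋂_{j > i} J_j` for `i = 0, …, r`.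
As `J₁, …, J_r` are indexed by `Fin r`, the ideal `J j` is the `(j+1)`-st one, and the condition
`j + 1 > i` reads `i ≤ j`. -/
def IsIrreducibleDecomposition {r : ℕ} (C : Fin (r + 1) → Ideal (MvPolynomial (Fin n) K))
    (J : Fin r → Ideal (MvPolynomial (Fin n) K)) : Prop :=
  (∀ j, IsIrreducibleMonomialIdeal (J j)) ∧
    ∀ i : Fin (r + 1), C i = ⨅ (j : Fin r) (_ : i ≤ j.castSucc), J j

end Algebra

/-! ### Multicomplexes in `ℕ∞ⁿ` -/

section Multicomplex

variable {n : ℕ}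

/-- The set of (componentwise) limits of ascending sequences in `Γ`. -/
def ascClosure (Γ : Set (Fin n → ℕ∞)) : Set (Fin n → ℕ∞) :=
  {a | ∃ s : ℕ → Fin n → ℕ∞, Monotone s ∧ (∀ k, s k ∈ Γ) ∧ Tendsto s atTop (𝓝 a)}

structure IsMulticomplex (Γ : Set (Fin n → ℕ∞)) : Prop where
  lower : ∀ a ∈ Γ, ∀ b, b ≤ a → b ∈ Γ
  closed : Γ = ascClosure Γ

/-- The smallest multicomplex `Γ(A)` containing `A`. -/
def multicomplexGen (A : Set (Fin n → ℕ∞)) : Set (Fin n → ℕ∞) :=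
  ⋂₀ {Γ | IsMulticomplex Γ ∧ A ⊆ Γ}

/-- The infinite part of `a`. -/
def infPart (a : Fin n → ℕ∞) : Set (Fin n) := {i | a i = ⊤}

/-- The set of facets of `Γ`: those `a ∈ Γ` with the same infinite part as every maximal
element `m ≥ a` of `Γ`. -/
def facets (Γ : Set (Fin n → ℕ∞)) : Set (Fin n → ℕ∞) :=
  {a | a ∈ Γ ∧ ∀ m, Maximal (· ∈ Γ) m → a ≤ m → infPart a = infPart m}

/-- The inclusion `ℕⁿ ⊆ ℕ∞ⁿ`. -/
def toENat (e : Fin n →₀ ℕ) : Fin n → ℕ∞ := fun i => (e i : ℕ∞)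

/-- The ideal `I(Γ)` generated by all monomials `x^e` with `e ∉ Γ`. -/
noncomputable def multicomplexIdeal (K : Type*) [Field K] (Γ : Set (Fin n → ℕ∞)) :
    Ideal (MvPolynomial (Fin n) K) :=
  Ideal.span ((fun e => monomial e (1 : K)) '' {e : Fin n →₀ ℕ | toENat e ∉ Γ})

/-- The multicomplex associated with a monomial ideal `I`: the smallest multicomplex containing
all `e ∈ ℕⁿ` with `x^e ∉ I`. -/
def associatedMulticomplex {K : Type*} [Field K] (I : Ideal (MvPolynomial (Fin n) K)) :
    Set (Fin n → ℕ∞) :=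
  multicomplexGen (toENat '' {e : Fin n →₀ ℕ | monomial e (1 : K) ∉ I})

theorem toENat_mono {e f : Fin n →₀ ℕ} (h : e ≤ f) : toENat e ≤ toENat f := fun i => by
  simpa [toENat] using h i

/-- For a multicomplex `Γ` the ideal `I(Γ)` is the `K`-span of the monomials `x^e`, `e ∉ Γ`. -/
theorem multicomplexIdeal_restrictScalars (K : Type*) [Field K] {Γ : Set (Fin n → ℕ∞)}
    (hΓ : IsMulticomplex Γ) :
    (multicomplexIdeal K Γ).restrictScalars K =
      Submodule.span K ((fun e => monomial e (1 : K)) '' {e : Fin n →₀ ℕ | toENat e ∉ Γ}) := by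
  apply le_antisymm
  · intro f hf
    have hf' : f ∈ multicomplexIdeal K Γ := hf
    rw [multicomplexIdeal, mem_ideal_span_monomial_image] at hf'
    rw [f.as_sum]
    refine Submodule.sum_mem _ fun e he => ?_
    have h1 : monomial e (f.coeff e) = f.coeff e • monomial e (1 : K) := by
      rw [smul_monomial, smul_eq_mul, mul_one]
    rw [h1]
    refine Submodule.smul_mem _ _ (Submodule.subset_span ⟨e, ?_, rfl⟩)
    obtain ⟨g, hg, hge⟩ := hf' e he
    exact fun h => hg (hΓ.lower _ h _ (toENat_mono hge))
  · rw [Submodule.span_le]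
    intro f hf
    exact Ideal.subset_span hf

/-- The smallest multicomplex containing `A` is a multicomplex. -/
theorem isMulticomplex_multicomplexGen (A : Set (Fin n → ℕ∞)) :
    IsMulticomplex (multicomplexGen A) where
  lower a ha b hb Γ hΓ := hΓ.1.lower a (ha Γ hΓ) b hb
  closed := by
    apply Set.Subset.antisymm
    · intro a ha
      exact ⟨fun _ => a, monotone_const, fun _ => ha, tendsto_const_nhds⟩
    · rintro a ⟨s, hs, hsA, ht⟩ Γ hΓ
      rw [hΓ.1.closed]
      exact ⟨s, hs, fun k => hsA k Γ hΓ, ht⟩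

/-- The multicomplex associated with a monomial ideal `I` satisfies `I(Γ) = I`. -/
theorem multicomplexIdeal_associatedMulticomplex {K : Type*} [Field K]
    {I : Ideal (MvPolynomial (Fin n) K)} (hI : IsMonomialIdeal I) :
    multicomplexIdeal K (associatedMulticomplex I) = I := by
  have key : ∀ e : Fin n →₀ ℕ,
      toENat e ∈ associatedMulticomplex I ↔ monomial e (1 : K) ∉ I := by
    intro e
    refine ⟨fun h => ?_, fun h Γ hΓ => hΓ.2 ⟨e, h, rfl⟩⟩
    refine h {a | ∀ f : Fin n →₀ ℕ, toENat f ≤ a → monomial f (1 : K) ∉ I} ⟨⟨?_, ?_⟩, ?_⟩ e le_rfl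
    · exact fun a ha b hb f hf => ha f (hf.trans hb)
    · apply Set.Subset.antisymm
      · intro a ha
        exact ⟨fun _ => a, monotone_const, fun _ => ha, tendsto_const_nhds⟩
      · rintro a ⟨s, hs, hsA, ht⟩ f hf
        have hev : ∀ᶠ k in atTop, toENat f ≤ s k := by
          have : ∀ i, ∀ᶠ k in atTop, toENat f i ≤ s k i := by
            intro i
            have hti := tendsto_pi_nhds.1 ht i
            rcases Nat.eq_zero_or_pos (f i) with h0 | h0
            · exact Eventually.of_forall fun k => by simp [toENat, h0]
            · have hlt : ((f i - 1 : ℕ) : ℕ∞) < a i := by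
                refine lt_of_lt_of_le ?_ (hf i)
                simp only [toENat, Nat.cast_lt]
                omega
              filter_upwards [hti.eventually (lt_mem_nhds hlt)] with k hk
              have := Order.add_one_le_of_lt hk
              refine le_trans (le_of_eq ?_) this
              simp only [toENat]
              exact_mod_cast (by omega : f i = f i - 1 + 1)
          exact (eventually_all.2 this).mono fun k hk i => hk i
        obtain ⟨k, hk⟩ := hev.exists
        exact hsA k f hk
    · rintro _ ⟨g, hg, rfl⟩ f hf hfI
      apply hg
      have hfg : f ≤ g := fun i => by simpa [toENat] using hf i
      have : monomial g (1 : K) = monomial (g - f) 1 * monomial f 1 := by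
        rw [monomial_mul, one_mul, tsub_add_cancel_of_le hfg]
      rw [this]
      exact I.mul_mem_left _ hfI
  apply le_antisymm
  · rw [multicomplexIdeal, Ideal.span_le]
    rintro _ ⟨e, he, rfl⟩
    by_contra hc
    exact he ((key e).2 hc)
  · obtain ⟨A, hA⟩ := hI
    conv_lhs => rw [hA]
    rw [Ideal.span_le]
    rintro _ ⟨e, he, rfl⟩
    refine Ideal.subset_span ⟨e, fun h => (key e).1 h ?_, rfl⟩
    rw [hA]
    exact Ideal.subset_span ⟨e, he, rfl⟩

end Multicomplex

end MultigradedFiltration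

namespace MultigradedFiltration

/-! ### Membership in monomial ideals, read on exponents. -/

section MonomialIdeals

variable {K : Type*} [Field K] {n : ℕ}

/-! Filtrations and chains correspond by taking preimages in `S`. Every multidegree of `S` has
dimension at most one, so the image of `1` under `(S/P_i)(-a_i) ≅ M_i/M_{i-1}` lifts to a scalar
times a monomial `u_i`; that it generates the factor and has annihilator `P_i` is exactly condition
(b).

The rest is combinatorics of exponents. The irreducible monomial ideals are exactly the ideals
`boxIdeal K b` with `b ∈ ℕ∞ⁿ`, and `b` is determined by the ideal. In a chain, the monomials in
`I_i` but not in `I_{i-1}` are `u_i` times the monomials in the variables outside `P_i`. Let `b_i`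
be the supremum of their exponents (`stanleyBound`): it equals `e_i` in the directions of `P_i` and
`∞` elsewhere. Then `I_{i-1} = I_i ∩ boxIdeal K b_i` (`monomial_mem_castSucc`), and descending
induction from `I_r = S` gives the decomposition. Conversely, `J_i` is forced to be this box ideal,
because on multiples of `u_i` it must agree with `I_{i-1}` (`eq_boxIdeal`).

It remains to see that the facets of `Γ` are the `b_i` (`facets_eq`). A pigeonhole argument puts
each element of `Γ` in some interval `[e_i, b_i]`, so maximal elements are among the `b_i`. If `b_i
≤ b_j`, then `j ≤ i` and `P_j ⊆ P_i`; pretty cleanness gives `P_i = P_j`, hence equal infinite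
parts. This makes every `b_i` a facet, and a facet in `[e_i, b_i]` must be `b_i`. -/

open scoped Classical in
theorem isMonomialIdeal_iff {I : Ideal (MvPolynomial (Fin n) K)} :
    IsMonomialIdeal I ↔ ∀ f ∈ I, ∀ e ∈ f.support, monomial e (1 : K) ∈ I := by
  constructor
  · rintro ⟨A, rfl⟩ f hf e he
    rw [mem_ideal_span_monomial_image] at hf ⊢
    intro x hx
    rw [support_monomial, if_neg one_ne_zero, Finset.mem_singleton] at hx
    exact hx ▸ hf e he
  · intro h
    refine ⟨{e | monomial e (1 : K) ∈ I}, le_antisymm (fun f hf => ?_) ?_⟩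
    · rw [mem_ideal_span_monomial_image]
      exact fun e he => ⟨e, h f hf e he, le_rfl⟩
    · rw [Ideal.span_le]
      rintro _ ⟨e, he, rfl⟩
      exact he

theorem mem_of_monomial_mem {I : Ideal (MvPolynomial (Fin n) K)} {f : MvPolynomial (Fin n) K}
    (h : ∀ e ∈ f.support, monomial e (1 : K) ∈ I) : f ∈ I := by
  rw [f.as_sum]
  refine I.sum_mem fun e he => ?_
  have h1 : monomial e (f.coeff e) = MvPolynomial.C (f.coeff e) * monomial e (1 : K) := by
    rw [C_mul_monomial, mul_one]
  rw [h1]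
  exact I.mul_mem_left _ (h e he)

theorem IsMonomialIdeal.mem_iff {I : Ideal (MvPolynomial (Fin n) K)} (hI : IsMonomialIdeal I)
    {f : MvPolynomial (Fin n) K} : f ∈ I ↔ ∀ e ∈ f.support, monomial e (1 : K) ∈ I :=
  ⟨fun hf => isMonomialIdeal_iff.1 hI f hf, mem_of_monomial_mem⟩

theorem IsMonomialIdeal.le_of_monomial {I J : Ideal (MvPolynomial (Fin n) K)}
    (hI : IsMonomialIdeal I)
    (h : ∀ e : Fin n →₀ ℕ, monomial e (1 : K) ∈ I → monomial e (1 : K) ∈ J) : I ≤ J :=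
  fun _ hf => mem_of_monomial_mem fun e he => h e (hI.mem_iff.1 hf e he)

theorem IsMonomialIdeal.ext {I J : Ideal (MvPolynomial (Fin n) K)}
    (hI : IsMonomialIdeal I) (hJ : IsMonomialIdeal J)
    (h : ∀ e : Fin n →₀ ℕ, monomial e (1 : K) ∈ I ↔ monomial e (1 : K) ∈ J) : I = J :=
  le_antisymm (hI.le_of_monomial fun e => (h e).1) (hJ.le_of_monomial fun e => (h e).2)

theorem IsMonomialIdeal.iInf {ι : Sort*} {J : ι → Ideal (MvPolynomial (Fin n) K)}
    (h : ∀ i, IsMonomialIdeal (J i)) : IsMonomialIdeal (⨅ i, J i) := by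
  rw [isMonomialIdeal_iff]
  intro f hf e he
  rw [Ideal.mem_iInf] at hf ⊢
  exact fun i => (h i).mem_iff.1 (hf i) e he

theorem monomial_mem_of_le {I : Ideal (MvPolynomial (Fin n) K)} {e f : Fin n →₀ ℕ} (h : e ≤ f)
    (he : monomial e (1 : K) ∈ I) : monomial f (1 : K) ∈ I := by
  have : monomial f (1 : K) = monomial (f - e) 1 * monomial e 1 := by
    rw [monomial_mul, one_mul, tsub_add_cancel_of_le h]
  rw [this]
  exact I.mul_mem_left _ he

open scoped Classical in
theorem monomial_mem_span_image {A : Set (Fin n →₀ ℕ)} {e : Fin n →₀ ℕ} :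
    monomial e (1 : K) ∈ Ideal.span ((fun e => monomial e (1 : K)) '' A) ↔ ∃ a ∈ A, a ≤ e := by
  rw [mem_ideal_span_monomial_image, support_monomial, if_neg one_ne_zero]
  simp

theorem monomial_mem_sup_span {I : Ideal (MvPolynomial (Fin n) K)} (hI : IsMonomialIdeal I)
    {e h : Fin n →₀ ℕ} :
    monomial h (1 : K) ∈ I ⊔ Ideal.span {monomial e (1 : K)} ↔
      monomial h (1 : K) ∈ I ∨ e ≤ h := by
  constructor
  · intro hm
    obtain ⟨A, rfl⟩ := hI
    rw [← Set.image_singleton (f := fun e => monomial e (1 : K)), ← Ideal.span_union,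
      ← Set.image_union, monomial_mem_span_image] at hm
    obtain ⟨a, ha | rfl, hae⟩ := hm
    · exact Or.inl (monomial_mem_span_image.2 ⟨a, ha, hae⟩)
    · exact Or.inr hae
  · rintro (hm | hm)
    · exact Ideal.mem_sup_left hm
    · exact Ideal.mem_sup_right (monomial_mem_of_le hm (Ideal.mem_span_singleton_self _))

theorem IsMonomialIdeal.sup_span {I : Ideal (MvPolynomial (Fin n) K)} (hI : IsMonomialIdeal I)
    (e : Fin n →₀ ℕ) : IsMonomialIdeal (I ⊔ Ideal.span {monomial e (1 : K)}) := by
  obtain ⟨A, rfl⟩ := hI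
  refine ⟨A ∪ {e}, ?_⟩
  rw [Set.image_union, Set.image_singleton, Ideal.span_union]

theorem IsMonomialIdeal.colon {I : Ideal (MvPolynomial (Fin n) K)} (hI : IsMonomialIdeal I)
    (e : Fin n →₀ ℕ) : IsMonomialIdeal (I.colon {monomial e (1 : K)}) := by
  rw [isMonomialIdeal_iff]
  intro f hf h hh
  rw [Submodule.mem_colon_singleton, smul_eq_mul] at hf ⊢
  rw [monomial_mul, one_mul]
  refine hI.mem_iff.1 hf _ ?_
  rw [mem_support_iff, coeff_mul_monomial, mul_one]
  exact mem_support_iff.1 hh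

end MonomialIdeals

/-! ### Box ideals and limits in `ℕ∞ⁿ`. -/

section Box

variable {n : ℕ}

theorem toENat_le_toENat {e f : Fin n →₀ ℕ} : toENat e ≤ toENat f ↔ e ≤ f :=
  ⟨fun h i => by simpa [toENat] using h i, toENat_mono⟩

/-- The ideal spanned by the monomials `x^e` with `e ≰ b`. -/
noncomputable def boxIdeal (K : Type*) [Field K] (b : Fin n → ℕ∞) :
    Ideal (MvPolynomial (Fin n) K) :=
  Ideal.span ((fun e => monomial e (1 : K)) '' {e : Fin n →₀ ℕ | ¬ toENat e ≤ b})

variable {K : Type*} [Field K]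

theorem isMonomialIdeal_boxIdeal (b : Fin n → ℕ∞) : IsMonomialIdeal (boxIdeal K b) := ⟨_, rfl⟩

theorem monomial_mem_boxIdeal {b : Fin n → ℕ∞} {e : Fin n →₀ ℕ} :
    monomial e (1 : K) ∈ boxIdeal K b ↔ ¬ toENat e ≤ b := by
  rw [boxIdeal, monomial_mem_span_image]
  exact ⟨fun ⟨a, ha, hae⟩ h => ha ((toENat_mono hae).trans h), fun h => ⟨e, h, le_rfl⟩⟩

/-- The vector with coordinates `min (b i) k`. -/
noncomputable def truncate (b : Fin n → ℕ∞) (k : ℕ) : Fin n →₀ ℕ :=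
  Finsupp.equivFunOnFinite.symm fun i => (min (b i) k).toNat

theorem coe_truncate (b : Fin n → ℕ∞) (k : ℕ) (i : Fin n) :
    ((truncate b k i : ℕ) : ℕ∞) = min (b i) k := by
  simp only [truncate, Finsupp.equivFunOnFinite_symm_apply_apply]
  exact ENat.natCast_toNat (ne_top_of_le_ne_top (ENat.natCast_ne_top k) (min_le_right _ _))

theorem toENat_truncate_le (b : Fin n → ℕ∞) (k : ℕ) : toENat (truncate b k) ≤ b := fun i =>
  (coe_truncate b k i).le.trans (min_le_left _ _)

theorem toENat_truncate_mono (b : Fin n → ℕ∞) : Monotone fun k => toENat (truncate b k) := by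
  intro k l hkl i
  simp only [toENat, coe_truncate]
  exact min_le_min_left _ (by exact_mod_cast hkl)

theorem tendsto_toENat_truncate (b : Fin n → ℕ∞) :
    Tendsto (fun k => toENat (truncate b k)) atTop (𝓝 b) := by
  rw [tendsto_pi_nhds]
  intro i
  have h : (b i) = ⨆ k : ℕ, toENat (truncate b k) i := by
    simp only [toENat, coe_truncate]
    rw [← inf_iSup_eq, ENat.iSup_natCast_eq_top.2, inf_top_eq]
    intro ⟨k, hk⟩
    exact absurd (hk ⟨k + 1, rfl⟩) (by simp)
  rw [h]
  exact tendsto_atTop_iSup fun k l hkl => toENat_truncate_mono b hkl i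

/-- A point of `ℕ∞ⁿ` is the limit of its finite truncations, so finite vectors detect the order. -/
theorem le_of_forall_toENat_le {b c : Fin n → ℕ∞}
    (h : ∀ e : Fin n →₀ ℕ, toENat e ≤ b → toENat e ≤ c) : b ≤ c :=
  le_of_tendsto' (tendsto_toENat_truncate b) fun k => h _ (toENat_truncate_le b k)

/-- For finite `f i > 0` the condition `f i ≤ x` is the open condition `f i - 1 < x`, and there are
only finitely many coordinates. -/
theorem toENat_le_of_tendsto {s : ℕ → Fin n → ℕ∞} {b : Fin n → ℕ∞}
    (hs : Tendsto s atTop (𝓝 b)) {f : Fin n →₀ ℕ} (hf : toENat f ≤ b) :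
    ∃ k, toENat f ≤ s k := by
  have hev : ∀ i, ∀ᶠ k in atTop, toENat f i ≤ s k i := by
    intro i
    have hti := tendsto_pi_nhds.1 hs i
    rcases Nat.eq_zero_or_pos (f i) with h0 | h0
    · exact Eventually.of_forall fun k => by simp [toENat, h0]
    · have hlt : ((f i - 1 : ℕ) : ℕ∞) < b i := by
        refine lt_of_lt_of_le ?_ (hf i)
        simp only [toENat, Nat.cast_lt]
        omega
      filter_upwards [hti.eventually (lt_mem_nhds hlt)] with k hk
      refine le_trans (le_of_eq ?_) (Order.add_one_le_of_lt hk)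
      simp only [toENat]
      exact_mod_cast (by omega : f i = f i - 1 + 1)
  exact ((eventually_all.2 hev).mono fun k hk i => hk i).exists

/-- Supplies the test multicomplexes that bound the intersection `multicomplexGen` from above. -/
theorem isMulticomplex_of_finite_condition (p : (Fin n →₀ ℕ) → Prop) :
    IsMulticomplex {a : Fin n → ℕ∞ | ∀ f : Fin n →₀ ℕ, toENat f ≤ a → p f} where
  lower a ha b hb f hf := ha f (hf.trans hb)
  closed := by
    apply Set.Subset.antisymm
    · exact fun a ha => ⟨fun _ => a, monotone_const, fun _ => ha, tendsto_const_nhds⟩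
    · rintro a ⟨s, -, hsA, ht⟩ f hf
      obtain ⟨k, hk⟩ := toENat_le_of_tendsto ht hf
      exact hsA k f hk

theorem multicomplexGen_singleton (b : Fin n → ℕ∞) : multicomplexGen {b} = Set.Iic b := by
  apply Set.Subset.antisymm
  · intro a ha
    exact le_of_forall_toENat_le fun e he =>
      ha _ ⟨isMulticomplex_of_finite_condition fun f => toENat f ≤ b, by simp⟩ e he
  · exact fun a ha Γ hΓ => hΓ.1.lower b (hΓ.2 rfl) a ha

theorem multicomplexIdeal_gen_singleton (b : Fin n → ℕ∞) :
    multicomplexIdeal K (multicomplexGen {b}) = boxIdeal K b := by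
  rw [multicomplexGen_singleton]
  rfl

theorem boxIdeal_injective : Function.Injective (boxIdeal K : (Fin n → ℕ∞) → _) := by
  intro b c h
  have key : ∀ e : Fin n →₀ ℕ, toENat e ≤ b ↔ toENat e ≤ c := fun e => by
    rw [← not_iff_not, ← monomial_mem_boxIdeal (K := K), h, monomial_mem_boxIdeal]
  exact le_antisymm (le_of_forall_toENat_le fun e => (key e).1)
    (le_of_forall_toENat_le fun e => (key e).2)

theorem mem_associatedMulticomplex {I : Ideal (MvPolynomial (Fin n) K)} {a : Fin n → ℕ∞} :
    a ∈ associatedMulticomplex I ↔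
      ∀ f : Fin n →₀ ℕ, toENat f ≤ a → monomial f (1 : K) ∉ I := by
  constructor
  · intro ha
    refine ha _ ⟨isMulticomplex_of_finite_condition fun f => monomial f (1 : K) ∉ I, ?_⟩
    rintro _ ⟨g, hg, rfl⟩ f hf hfI
    exact hg (monomial_mem_of_le (toENat_le_toENat.1 hf) hfI)
  · intro h Γ hΓ
    rw [hΓ.1.closed]
    exact ⟨_, toENat_truncate_mono a,
      fun k => hΓ.2 ⟨_, h _ (toENat_truncate_le a k), rfl⟩, tendsto_toENat_truncate a⟩

end Box

/-! ### Irreducible monomial ideals are the box ideals. -/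

section Irreducible

variable {K : Type*} [Field K] {n : ℕ}

/-- A socle argument: the class of `w` in `R/J` has prime annihilator `P`, and every ideal strictly
above `J` contains some `g * w` with `g ∉ P`. Two such ideals share a product `g * h * w`, which is
not in `J`. -/
theorem infIrred_of_colon {R : Type*} [CommRing R] {J P : Ideal R} (w : R) (hP : P.IsPrime)
    (hw : ∀ p, p * w ∈ J ↔ p ∈ P) (hJ : ∀ f ∉ J, ∃ y g, f * y - g * w ∈ J ∧ g ∉ P) :
    InfIrred J := by
  refine ⟨fun hmax => ?_, fun {a b} hab => ?_⟩
  · apply hP.ne_top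
    rw [Ideal.eq_top_iff_one, ← hw, isMax_iff_eq_top.1 hmax]
    trivial
  · by_contra! hne
    have key : ∀ c : Ideal R, J ≤ c → c ≠ J → ∃ g, g * w ∈ c ∧ g ∉ P := by
      intro c hc hcJ
      obtain ⟨f, hf, hfJ⟩ := SetLike.exists_of_lt (lt_of_le_of_ne hc (Ne.symm hcJ))
      obtain ⟨y, g, hfg, hg⟩ := hJ f hfJ
      refine ⟨g, ?_, hg⟩
      have := c.sub_mem (c.mul_mem_right y hf) (hc hfg)
      rwa [sub_sub_cancel] at this
    obtain ⟨g, hga, hg⟩ := key a (hab ▸ inf_le_left) hne.1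
    obtain ⟨h, hhb, hh⟩ := key b (hab ▸ inf_le_right) hne.2
    have : g * h ∈ P := by
      rw [← hw, ← hab]
      refine ⟨?_, ?_⟩
      · rw [mul_comm g h, mul_assoc]
        exact a.mul_mem_left _ hga
      · rw [mul_assoc]
        exact b.mul_mem_left _ hhb
    exact (hP.mem_or_mem this).elim hg hh

-- The ideal is the kernel of the substitution that sets the variables in `A` to zero, and the
-- target is a domain.
open scoped Classical in
theorem isPrime_span_X_image {σ : Type*} (A : Set σ) :
    (Ideal.span ((X : σ → MvPolynomial σ K) '' A)).IsPrime := by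
  let ρ : MvPolynomial σ K →ₐ[K] MvPolynomial σ K := aeval fun k => if k ∈ A then 0 else X k
  have h : Ideal.span ((X : σ → MvPolynomial σ K) '' A) = RingHom.ker ρ := by
    apply le_antisymm
    · rw [Ideal.span_le]
      rintro _ ⟨k, hk, rfl⟩
      change ρ (X k) = 0
      simp [ρ, hk]
    · intro f hf
      have hcomp : (Ideal.Quotient.mkₐ K (Ideal.span ((X : σ → MvPolynomial σ K) '' A))).comp ρ =
          Ideal.Quotient.mkₐ K _ := by
        ext k
        by_cases hk : k ∈ A
        · have : Ideal.Quotient.mk (Ideal.span ((X : σ → MvPolynomial σ K) '' A)) (X k) = 0 :=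
            Ideal.Quotient.eq_zero_iff_mem.2 (Ideal.subset_span ⟨k, hk, rfl⟩)
          simp [ρ, hk, this]
        · simp [ρ, hk]
      have := DFunLike.congr_fun hcomp f
      rw [AlgHom.comp_apply, show ρ f = 0 from hf, map_zero] at this
      exact Ideal.Quotient.eq_zero_iff_mem.1 this.symm
  rw [h]
  exact RingHom.ker_isPrime _

/-- The finite coordinates of `b`. -/
noncomputable def finPart (b : Fin n → ℕ∞) : Fin n →₀ ℕ :=
  Finsupp.equivFunOnFinite.symm fun k => (b k).toNat

theorem coe_finPart {b : Fin n → ℕ∞} {k : Fin n} (h : b k ≠ ⊤) : (finPart b k : ℕ∞) = b k := by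
  simpa [finPart] using ENat.natCast_toNat h

theorem finPart_of_eq_top {b : Fin n → ℕ∞} {k : Fin n} (h : b k = ⊤) : finPart b k = 0 := by
  simp [finPart, h]

theorem toENat_add_finPart_le_iff {b : Fin n → ℕ∞} {e : Fin n →₀ ℕ} :
    toENat (e + finPart b) ≤ b ↔ ∀ k, b k ≠ ⊤ → e k = 0 := by
  refine forall_congr' fun k => ?_
  by_cases h : b k = ⊤
  · simp [h]
  · simp only [toENat, ne_eq, h, not_false_eq_true, forall_const]
    rw [← coe_finPart h, Nat.cast_le, Finsupp.add_apply]
    omega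

theorem mul_finPart_mem_boxIdeal {b : Fin n → ℕ∞} {p : MvPolynomial (Fin n) K} :
    p * monomial (finPart b) 1 ∈ boxIdeal K b ↔
      p ∈ Ideal.span ((X : Fin n → MvPolynomial (Fin n) K) '' {k | b k ≠ ⊤}) := by
  have key : p * monomial (finPart b) 1 ∈ boxIdeal K b ↔
      ∀ m ∈ p.support, ¬ toENat (m + finPart b) ≤ b := by
    rw [(isMonomialIdeal_boxIdeal b).mem_iff]
    simp only [monomial_mem_boxIdeal, mem_support_iff]
    constructor
    · intro h m hm
      exact h _ (by rwa [coeff_mul_monomial, mul_one])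
    · intro h m hm
      rw [coeff_mul_monomial'] at hm
      split_ifs at hm with hle
      · have := h (m - finPart b) (by simpa using hm)
        rwa [tsub_add_cancel_of_le hle] at this
      · exact absurd rfl hm
  rw [key, mem_ideal_span_X_image]
  refine forall₂_congr fun m _ => ?_
  rw [toENat_add_finPart_le_iff]
  push Not
  rfl

-- The second hypothesis of `infIrred_of_colon`: a suitable monomial moves `f`, modulo the box
-- ideal, onto a multiple of the socle monomial.
open scoped Classical in
theorem exists_mul_sub_mem_boxIdeal {b : Fin n → ℕ∞} {f : MvPolynomial (Fin n) K}
    (hf : f ∉ boxIdeal K b) :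
    ∃ y g, f * y - g * monomial (finPart b) 1 ∈ boxIdeal K b ∧
      g ∉ Ideal.span ((X : Fin n → MvPolynomial (Fin n) K) '' {k | b k ≠ ⊤}) := by
  have hne : (f.support.filter fun e => toENat e ≤ b).Nonempty := by
    rw [(isMonomialIdeal_boxIdeal b).mem_iff] at hf
    push Not at hf
    obtain ⟨e, he, heb⟩ := hf
    rw [monomial_mem_boxIdeal, not_not] at heb
    exact ⟨e, Finset.mem_filter.2 ⟨he, heb⟩⟩
  -- Among the terms of `f` inside the box, `s` has least total degree in the finite directions.
  -- Multiplying by `x^c` brings `s` to the wall of the box in all these directions; any other term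
  -- still inside then has finite coordinates at most those of `s`, hence equal to them by
  -- minimality.
  obtain ⟨s, hs, hmin⟩ := Finset.exists_min_image _
    (fun e : Fin n →₀ ℕ => ∑ k with b k ≠ ⊤, e k) hne
  simp only [Finset.mem_filter] at hs hmin
  have hsb : ∀ k, b k ≠ ⊤ → s k ≤ finPart b k := fun k hk => by
    have := hs.2 k
    rw [← coe_finPart hk] at this
    simpa [toENat] using this
  set c : Fin n →₀ ℕ := finPart b - s with hc
  have hcb : ∀ k, b k ≠ ⊤ → c k + s k = finPart b k := fun k hk => by
    have := hsb k hk
    simp only [hc, Finsupp.tsub_apply]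
    omega
  set F := f * monomial c (1 : K) with hF
  have hdiff : F - (F.divMonomial (finPart b)) * monomial (finPart b) 1 ∈ boxIdeal K b := by
    have : F - (F.divMonomial (finPart b)) * monomial (finPart b) 1 = F.modMonomial (finPart b) := by
      rw [sub_eq_iff_eq_add, mul_comm, modMonomial_add_divMonomial]
    rw [this]
    refine mem_of_monomial_mem fun m hm => ?_
    rw [monomial_mem_boxIdeal]
    intro hmb
    rw [mem_support_iff] at hm
    by_cases hle : finPart b ≤ m
    · exact hm (coeff_modMonomial_of_le _ hle)
    · rw [coeff_modMonomial_of_not_le _ hle, hF, coeff_mul_monomial', mul_one] at hm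
      split_ifs at hm with hcm
      · have ht := hmin (m - c) ⟨mem_support_iff.2 hm,
          (toENat_mono tsub_le_self).trans hmb⟩
        have hle' : ∀ k, b k ≠ ⊤ → (m - c) k ≤ s k := fun k hk => by
          have h1 := hmb k
          rw [← coe_finPart hk] at h1
          have h2 : m k ≤ finPart b k := by simpa [toENat] using h1
          have h3 := hcb k hk
          simp only [Finsupp.tsub_apply]
          omega
        have heq := (Finset.sum_eq_sum_iff_of_le
          (fun k hk => hle' k (Finset.mem_filter.1 hk).2)).1
          (le_antisymm (Finset.sum_le_sum fun k hk => hle' k (Finset.mem_filter.1 hk).2) ht)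
        apply hle
        intro k
        by_cases hk : b k = ⊤
        · simp [finPart_of_eq_top hk]
        · have h1 := heq k (by simpa using hk)
          have h2 := hcb k hk
          have h3 := hcm k
          simp only [Finsupp.tsub_apply] at h1
          omega
      · exact hm rfl
  refine ⟨monomial c 1, F.divMonomial (finPart b), hdiff, fun hg => ?_⟩
  have hFJ : F ∈ boxIdeal K b := by
    have := (boxIdeal K b).add_mem hdiff (mul_finPart_mem_boxIdeal.2 hg)
    rwa [sub_add_cancel] at this
  -- The term `s + c` survives in `F` and still lies in the box, so `F` is not in the box ideal.
  have hsc : s + c ∈ F.support := by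
    rw [mem_support_iff, hF, coeff_mul_monomial, mul_one]
    exact mem_support_iff.1 hs.1
  refine monomial_mem_boxIdeal.1 ((isMonomialIdeal_boxIdeal b).mem_iff.1 hFJ _ hsc) fun k => ?_
  by_cases hk : b k = ⊤
  · simp [hk]
  · rw [← coe_finPart hk, ← hcb k hk, add_comm]
    rfl

theorem isIrreducibleMonomialIdeal_boxIdeal (b : Fin n → ℕ∞) :
    IsIrreducibleMonomialIdeal (boxIdeal K b) :=
  ⟨isMonomialIdeal_boxIdeal b, infIrred_of_colon _ (isPrime_span_X_image _)
    (fun _ => mul_finPart_mem_boxIdeal) fun _ => exists_mul_sub_mem_boxIdeal⟩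

/-- Otherwise `J = (J, x^e) ∩ (J, x^f)` with both ideals strictly larger. -/
theorem IsIrreducibleMonomialIdeal.sup_notMem {J : Ideal (MvPolynomial (Fin n) K)}
    (hJ : IsIrreducibleMonomialIdeal J) {e f : Fin n →₀ ℕ} (he : monomial e (1 : K) ∉ J)
    (hf : monomial f (1 : K) ∉ J) : monomial (e ⊔ f) (1 : K) ∉ J := by
  intro hef
  have h : (J ⊔ Ideal.span {monomial e (1 : K)}) ⊓ (J ⊔ Ideal.span {monomial f (1 : K)}) = J := by
    refine le_antisymm (fun p hp => mem_of_monomial_mem fun m hm => ?_)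
      (le_inf le_sup_left le_sup_left)
    have h1 := (hJ.1.sup_span e).mem_iff.1 hp.1 m hm
    have h2 := (hJ.1.sup_span f).mem_iff.1 hp.2 m hm
    rw [monomial_mem_sup_span hJ.1] at h1 h2
    rcases h1 with h1 | h1
    · exact h1
    · rcases h2 with h2 | h2
      · exact h2
      · exact monomial_mem_of_le (sup_le h1 h2) hef
  have hmem : ∀ g : Fin n →₀ ℕ, J ⊔ Ideal.span {monomial g (1 : K)} = J →
      monomial g (1 : K) ∈ J := fun g hg =>
    hg ▸ Ideal.mem_sup_right (Ideal.mem_span_singleton_self _)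
  rcases hJ.2.2 h with h | h
  · exact he (hmem e h)
  · exact hf (hmem f h)

/-- The exponents outside `J` are closed under divisors and, by irreducibility, under finite
suprema, so they fill the box below their supremum. -/
theorem IsIrreducibleMonomialIdeal.exists_eq_boxIdeal {J : Ideal (MvPolynomial (Fin n) K)}
    (hJ : IsIrreducibleMonomialIdeal J) : ∃ b, J = boxIdeal K b := by
  refine ⟨fun k => ⨆ e : {e : Fin n →₀ ℕ // monomial e (1 : K) ∉ J}, (e.1 k : ℕ∞),
    hJ.1.ext (isMonomialIdeal_boxIdeal _) fun f => ?_⟩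
  rw [monomial_mem_boxIdeal, ← not_iff_not, not_not]
  constructor
  · exact fun hf k => le_iSup (fun e : {e : Fin n →₀ ℕ // monomial e (1 : K) ∉ J} =>
      (e.1 k : ℕ∞)) ⟨f, hf⟩
  · intro hf
    have h0 : monomial (0 : Fin n →₀ ℕ) (1 : K) ∉ J := fun h =>
      hJ.2.ne_top (J.eq_top_iff_one.2 h)
    have hk : ∀ k, ∃ e : Fin n →₀ ℕ, monomial e (1 : K) ∉ J ∧ f k ≤ e k := by
      intro k
      rcases Nat.eq_zero_or_pos (f k) with hz | hz
      · exact ⟨0, h0, by simp [hz]⟩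
      · have hlt : ((f k - 1 : ℕ) : ℕ∞) <
            ⨆ e : {e : Fin n →₀ ℕ // monomial e (1 : K) ∉ J}, (e.1 k : ℕ∞) := by
          refine lt_of_lt_of_le ?_ (hf k)
          simp only [toENat, Nat.cast_lt]
          omega
        obtain ⟨e, he⟩ := lt_iSup_iff.1 hlt
        exact ⟨e.1, e.2, by have := Nat.cast_lt.1 he; omega⟩
    choose E hE hfE using hk
    have hsup : ∀ s : Finset (Fin n), monomial (s.sup E) (1 : K) ∉ J := by
      intro s
      classical
      induction s using Finset.induction_on with
      | empty => exact h0
      | insert k s _ ih =>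
        rw [Finset.sup_insert]
        exact hJ.sup_notMem (hE k) ih
    refine fun hfJ => hsup Finset.univ (monomial_mem_of_le (fun k => ?_) hfJ)
    exact (hfE k).trans (Finset.le_sup (f := E) (Finset.mem_univ k) k)

end Irreducible

/-! ### Chains of monomial ideals, their decompositions and facets. -/

section Chain

variable {K : Type*} [Field K] {n : ℕ}

theorem monomial_mem_prime_iff {P : Ideal (MvPolynomial (Fin n) K)} (hP : P.IsPrime)
    {w : Fin n →₀ ℕ} : monomial w (1 : K) ∈ P ↔ ∃ k, X k ∈ P ∧ w k ≠ 0 := by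
  have h : monomial w (1 : K) = ∏ k, X k ^ w k := by
    rw [monomial_eq, C_1, one_mul, Finsupp.prod_fintype _ _ fun _ => pow_zero _]
  constructor
  · intro hw
    rw [h, hP.prod_mem_iff] at hw
    obtain ⟨k, -, hk⟩ := hw
    refine ⟨k, hP.mem_of_pow_mem _ hk, fun h0 => hP.ne_top ?_⟩
    rw [h0, pow_zero] at hk
    exact P.eq_top_iff_one.2 hk
  · rintro ⟨k, hk, hwk⟩
    rw [h, hP.prod_mem_iff]
    exact ⟨k, Finset.mem_univ k, P.pow_mem_of_mem hk _ (Nat.pos_of_ne_zero hwk)⟩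

theorem le_of_forall_X_mem {P Q : Ideal (MvPolynomial (Fin n) K)} (hP : P.IsPrime)
    (hPm : IsMonomialIdeal P) (hQ : Q.IsPrime) (h : ∀ k, X k ∈ P → X k ∈ Q) : P ≤ Q :=
  hPm.le_of_monomial fun e he => by
    obtain ⟨k, hk, hek⟩ := (monomial_mem_prime_iff hP).1 he
    exact (monomial_mem_prime_iff hQ).2 ⟨k, h k hk, hek⟩

open scoped Classical in
/-- The supremum in `ℕ∞ⁿ` of the exponents of the monomials in `x^e · K[xₖ : xₖ ∉ P]`. -/
noncomputable def stanleyBound (P : Ideal (MvPolynomial (Fin n) K)) (e : Fin n →₀ ℕ) :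
    Fin n → ℕ∞ :=
  fun k => if X k ∈ P then (e k : ℕ∞) else ⊤

theorem toENat_le_stanleyBound_iff {P : Ideal (MvPolynomial (Fin n) K)} {e h : Fin n →₀ ℕ} :
    toENat h ≤ stanleyBound P e ↔ ∀ k, X k ∈ P → h k ≤ e k := by
  refine forall_congr' fun k => ?_
  by_cases hk : X k ∈ P <;> simp [stanleyBound, toENat, hk]

theorem toENat_le_stanleyBound (P : Ideal (MvPolynomial (Fin n) K)) (e : Fin n →₀ ℕ) :
    toENat e ≤ stanleyBound P e :=
  toENat_le_stanleyBound_iff.2 fun _ _ => le_rfl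

theorem infPart_stanleyBound (P : Ideal (MvPolynomial (Fin n) K)) (e : Fin n →₀ ℕ) :
    infPart (stanleyBound P e) = {k | X k ∉ P} := by
  ext k
  by_cases hk : X k ∈ P <;> simp [infPart, stanleyBound, hk]

theorem toENat_sup_le {e h : Fin n →₀ ℕ} {b : Fin n → ℕ∞} (he : toENat e ≤ b)
    (hh : toENat h ≤ b) : toENat (e ⊔ h) ≤ b := fun k => by
  rcases le_total (e k) (h k) with hk | hk
  · simpa [toENat, hk] using hh k
  · simpa [toENat, hk] using he k

/-- Once `e ≤ b`, the conditions `f ≤ b` and `e ⊔ f ≤ b` are equivalent, so it suffices to test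
vectors above `e`. -/
theorem eq_of_forall_ge_toENat_le_iff {e : Fin n →₀ ℕ} {b c : Fin n → ℕ∞} (hb : toENat e ≤ b)
    (hc : toENat e ≤ c) (h : ∀ f, e ≤ f → (toENat f ≤ b ↔ toENat f ≤ c)) : b = c := by
  refine le_antisymm (le_of_forall_toENat_le fun f hf => ?_) (le_of_forall_toENat_le fun f hf => ?_)
  · exact (toENat_mono le_sup_right).trans ((h (e ⊔ f) le_sup_left).1 (toENat_sup_le hb hf))
  · exact (toENat_mono le_sup_right).trans ((h (e ⊔ f) le_sup_left).2 (toENat_sup_le hc hf))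

namespace IsMonomialPrimeChain

variable {I : Ideal (MvPolynomial (Fin n) K)} {r : ℕ}
  {C : Fin (r + 1) → Ideal (MvPolynomial (Fin n) K)} {e : Fin r → Fin n →₀ ℕ}
  {P : Fin r → Ideal (MvPolynomial (Fin n) K)} {a : Fin r → Fin n → ℤ}

theorem prime_monomial (hC : IsMonomialPrimeChain I C e P a) (i : Fin r) :
    IsMonomialIdeal (P i) :=
  hC.colon i ▸ (hC.monomial _).colon _

theorem monomial_mem_succ (hC : IsMonomialPrimeChain I C e P a) (i : Fin r) {h : Fin n →₀ ℕ} :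
    MvPolynomial.monomial h (1 : K) ∈ C i.succ ↔
      MvPolynomial.monomial h (1 : K) ∈ C i.castSucc ∨ e i ≤ h := by
  rw [hC.succ i, monomial_mem_sup_span (hC.monomial _)]

/-- Dividing by `u_i` turns membership into `x^(h - e_i) ∈ P_i`, which means that some variable of
`P_i` divides it. -/
theorem monomial_mem_castSucc_of_le (hC : IsMonomialPrimeChain I C e P a) (i : Fin r)
    {h : Fin n →₀ ℕ} (hh : e i ≤ h) :
    MvPolynomial.monomial h (1 : K) ∈ C i.castSucc ↔ ¬ toENat h ≤ stanleyBound (P i) (e i) := by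
  have h1 : MvPolynomial.monomial h (1 : K) ∈ C i.castSucc ↔
      MvPolynomial.monomial (h - e i) (1 : K) ∈ P i := by
    rw [← hC.colon i, Submodule.mem_colon_singleton, smul_eq_mul, monomial_mul, one_mul,
      tsub_add_cancel_of_le hh]
  rw [h1, monomial_mem_prime_iff (hC.prime i), toENat_le_stanleyBound_iff]
  push Not
  refine exists_congr fun k => and_congr_right fun _ => ?_
  have := hh k
  simp only [Finsupp.tsub_apply]
  omega

/-- The identity `I_{i-1} = I_i ∩ J_i` on monomials. Replacing `h` by `e i ⊔ h` reduces the forward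
direction to multiples of `u_i`. -/
theorem monomial_mem_castSucc (hC : IsMonomialPrimeChain I C e P a) (i : Fin r)
    {h : Fin n →₀ ℕ} :
    MvPolynomial.monomial h (1 : K) ∈ C i.castSucc ↔
      MvPolynomial.monomial h (1 : K) ∈ C i.succ ∧ ¬ toENat h ≤ stanleyBound (P i) (e i) := by
  constructor
  · intro hm
    refine ⟨(hC.monomial_mem_succ i).2 (Or.inl hm), fun hb => ?_⟩
    exact (hC.monomial_mem_castSucc_of_le i le_sup_left).1 (monomial_mem_of_le le_sup_right hm)
      (toENat_sup_le (toENat_le_stanleyBound _ _) hb)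
  · rintro ⟨hm, hb⟩
    rcases (hC.monomial_mem_succ i).1 hm with hm | hm
    · exact hm
    · exact (hC.monomial_mem_castSucc_of_le i hm).2 hb

theorem castSucc_le_castSucc_iff_eq_or {i j : Fin r} :
    i.castSucc ≤ j.castSucc ↔ j = i ∨ i.succ ≤ j.castSucc := by
  simp only [Fin.le_def, Fin.val_castSucc, Fin.val_succ, Fin.ext_iff]
  omega

theorem monomial_mem_iff (hC : IsMonomialPrimeChain I C e P a) (i : Fin (r + 1))
    {h : Fin n →₀ ℕ} :
    MvPolynomial.monomial h (1 : K) ∈ C i ↔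
      ∀ j : Fin r, i ≤ j.castSucc → ¬ toENat h ≤ stanleyBound (P j) (e j) := by
  induction i using Fin.reverseInduction with
  | last =>
    rw [hC.last]
    refine ⟨fun _ j hj => absurd hj (not_le.2 (Fin.castSucc_lt_last j)), fun _ => trivial⟩
  | cast i ih =>
    rw [hC.monomial_mem_castSucc, ih]
    simp only [castSucc_le_castSucc_iff_eq_or]
    constructor
    · rintro ⟨h1, h2⟩ j (rfl | hj)
      · exact h2
      · exact h1 j hj
    · exact fun H => ⟨fun j hj => H j (Or.inr hj), H i (Or.inl rfl)⟩

theorem isIrreducibleDecomposition_boxIdeal (hC : IsMonomialPrimeChain I C e P a) :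
    IsIrreducibleDecomposition C fun j => boxIdeal K (stanleyBound (P j) (e j)) := by
  refine ⟨fun j => isIrreducibleMonomialIdeal_boxIdeal _, fun i => ?_⟩
  refine (hC.monomial i).ext (.iInf fun j => .iInf fun _ => isMonomialIdeal_boxIdeal _) fun h => ?_
  simp only [hC.monomial_mem_iff, Ideal.mem_iInf, monomial_mem_boxIdeal]

/-- Consecutive intersections give `I_{j-1} = I_j ∩ J_j`. All multiples of `u_j` lie in `I_j`, so on
them `J_j` agrees with `I_{j-1}`, and this determines its bound. -/
theorem eq_boxIdeal (hC : IsMonomialPrimeChain I C e P a)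
    {J : Fin r → Ideal (MvPolynomial (Fin n) K)} (hJ : IsIrreducibleDecomposition C J) :
    J = fun j => boxIdeal K (stanleyBound (P j) (e j)) := by
  funext j
  obtain ⟨b, hb⟩ := (hJ.1 j).exists_eq_boxIdeal
  have key : ∀ h : Fin n →₀ ℕ, MvPolynomial.monomial h (1 : K) ∈ C j.castSucc ↔
      MvPolynomial.monomial h (1 : K) ∈ C j.succ ∧ ¬ toENat h ≤ b := by
    intro h
    rw [hJ.2, hJ.2]
    simp only [Ideal.mem_iInf, castSucc_le_castSucc_iff_eq_or]
    rw [← monomial_mem_boxIdeal (K := K), ← hb]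
    constructor
    · exact fun H => ⟨fun i hi => H i (Or.inr hi), H j (Or.inl rfl)⟩
    · rintro ⟨h1, h2⟩ i (rfl | hi)
      · exact h2
      · exact h1 i hi
  have hiff : ∀ f, e j ≤ f → (toENat f ≤ b ↔ toENat f ≤ stanleyBound (P j) (e j)) := by
    intro f hf
    have h1 := (key f).symm.trans (hC.monomial_mem_castSucc_of_le j hf)
    have h2 := (hC.monomial_mem_succ j).2 (Or.inr hf)
    tauto
  rw [hb, eq_of_forall_ge_toENat_le_iff ((hiff _ le_rfl).2 (toENat_le_stanleyBound _ _))
    (toENat_le_stanleyBound _ _) hiff]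

/-- If `i < j`, then `u_i` lies in `I_i ⊆ I_{j-1} ⊆ J_j`, whereas its exponent is below `b_i ≤ b_j`.
-/
theorem le_of_stanleyBound_le (hC : IsMonomialPrimeChain I C e P a) {i j : Fin r}
    (h : stanleyBound (P i) (e i) ≤ stanleyBound (P j) (e j)) : j ≤ i := by
  by_contra! hij
  have h1 : MvPolynomial.monomial (e i) (1 : K) ∈ C i.succ :=
    (hC.monomial_mem_succ i).2 (Or.inr le_rfl)
  have h2 : i.succ ≤ j.castSucc := hij
  exact (hC.monomial_mem_iff _).1 h1 j h2 ((toENat_le_stanleyBound _ _).trans h)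

theorem stanleyBound_injective (hC : IsMonomialPrimeChain I C e P a) :
    Function.Injective fun j => stanleyBound (P j) (e j) := fun _ _ h =>
  le_antisymm (hC.le_of_stanleyBound_le (ge_of_eq h)) (hC.le_of_stanleyBound_le (le_of_eq h))

theorem infPart_eq_of_le (hC : IsMonomialPrimeChain I C e P a) (hP : IsPrettyClean P) {i j : Fin r}
    (h : stanleyBound (P i) (e i) ≤ stanleyBound (P j) (e j)) :
    infPart (stanleyBound (P i) (e i)) = infPart (stanleyBound (P j) (e j)) := by
  rcases (hC.le_of_stanleyBound_le h).eq_or_lt with rfl | hji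
  · rfl
  · rw [infPart_stanleyBound, infPart_stanleyBound, hP j i hji]
    refine le_of_forall_X_mem (hC.prime j) (hC.prime_monomial j) (hC.prime i) fun k hk => ?_
    by_contra hki
    have := h k
    simp [stanleyBound, hk, hki] at this

/-- Follow `x^h` up the chain to the step `i` where it enters. -/
theorem exists_le_of_notMem (hC : IsMonomialPrimeChain I C e P a) {h : Fin n →₀ ℕ}
    (hh : MvPolynomial.monomial h (1 : K) ∉ I) :
    ∃ i, e i ≤ h ∧ toENat h ≤ stanleyBound (P i) (e i) := by
  by_contra! H
  have key : ∀ i, MvPolynomial.monomial h (1 : K) ∉ C i := by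
    intro i
    induction i using Fin.induction with
    | zero => rwa [hC.zero]
    | succ i ih =>
      rw [hC.monomial_mem_succ]
      rintro (h1 | h1)
      · exact ih h1
      · exact ih ((hC.monomial_mem_castSucc_of_le i h1).2 (H i h1))
  exact key (Fin.last r) (hC.last ▸ trivial)

/-- Each truncation of `b` lies in one of finitely many intervals `[e_i, b_i]`. One index serves
infinitely many truncations, and the upper bound passes to the limit. -/
theorem exists_le_of_mem_associatedMulticomplex (hC : IsMonomialPrimeChain I C e P a)
    {b : Fin n → ℕ∞} (hb : b ∈ associatedMulticomplex I) :
    ∃ i, toENat (e i) ≤ b ∧ b ≤ stanleyBound (P i) (e i) := by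
  have h : ∀ k, ∃ i, e i ≤ truncate b k ∧ toENat (truncate b k) ≤ stanleyBound (P i) (e i) :=
    fun k => hC.exists_le_of_notMem (mem_associatedMulticomplex.1 hb _ (toENat_truncate_le b k))
  choose g hg using h
  obtain ⟨i, hi⟩ := Finite.exists_infinite_fiber g
  rw [Set.infinite_coe_iff] at hi
  refine ⟨i, ?_, ?_⟩
  · obtain ⟨k, hk⟩ := hi.nonempty
    obtain rfl : g k = i := hk
    exact (toENat_mono (hg k).1).trans (toENat_truncate_le b k)
  · refine le_of_tendsto' (tendsto_toENat_truncate b) fun k => ?_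
    obtain ⟨l, hl, hkl⟩ := hi.exists_gt k
    obtain rfl : g l = i := hl
    exact (toENat_truncate_mono b hkl.le).trans (hg l).2

theorem mem_associatedMulticomplex_of_le (hC : IsMonomialPrimeChain I C e P a)
    {b : Fin n → ℕ∞} {i : Fin r} (h : b ≤ stanleyBound (P i) (e i)) :
    b ∈ associatedMulticomplex I := by
  rw [mem_associatedMulticomplex]
  intro f hf hfI
  rw [← hC.zero] at hfI
  exact (hC.monomial_mem_iff 0).1 hfI i (Fin.zero_le _) (hf.trans h)

theorem facets_eq (hC : IsMonomialPrimeChain I C e P a) (hP : IsPrettyClean P) :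
    facets (associatedMulticomplex I) = Set.range fun i => stanleyBound (P i) (e i) := by
  have hmaxle : ∀ {m}, Maximal (· ∈ associatedMulticomplex I) m →
      ∃ i, m = stanleyBound (P i) (e i) := fun hm => by
    obtain ⟨i, -, hi⟩ := hC.exists_le_of_mem_associatedMulticomplex hm.prop
    exact ⟨i, le_antisymm hi (hm.le_of_ge (hC.mem_associatedMulticomplex_of_le le_rfl) hi)⟩
  have hfacet : ∀ i m, Maximal (· ∈ associatedMulticomplex I) m →
      stanleyBound (P i) (e i) ≤ m → infPart (stanleyBound (P i) (e i)) = infPart m := by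
    intro i m hm him
    obtain ⟨j, rfl⟩ := hmaxle hm
    exact hC.infPart_eq_of_le hP him
  apply Set.Subset.antisymm
  · rintro b ⟨hb, hbm⟩
    obtain ⟨i, hib, hbi⟩ := hC.exists_le_of_mem_associatedMulticomplex hb
    -- An element maximal among the finitely many `b_j` is maximal in `Γ`, since each element of `Γ`
    -- lies below some `b_j`. Both `b` and `b_i` lie below `m`, which makes their infinite parts
    -- comparable.
    obtain ⟨m, him, hm⟩ := (Set.finite_range fun i => stanleyBound (P i) (e i)).exists_le_maximal
      (Set.mem_range_self i)
    have hmΓ : Maximal (· ∈ associatedMulticomplex I) m := by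
      obtain ⟨j, hj⟩ := hm.prop
      refine ⟨hC.mem_associatedMulticomplex_of_le hj.ge, fun y hy hmy => ?_⟩
      obtain ⟨l, -, hl⟩ := hC.exists_le_of_mem_associatedMulticomplex hy
      exact hl.trans (hm.le_of_ge ⟨l, rfl⟩ (hmy.trans hl))
    have hinf : infPart (stanleyBound (P i) (e i)) = infPart b :=
      (hfacet i m hmΓ him).trans (hbm m hmΓ (hbi.trans him)).symm
    refine ⟨i, le_antisymm (fun k => ?_) hbi⟩
    by_cases hk : X k ∈ P i
    · simpa [stanleyBound, hk, toENat] using hib k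
    · have : k ∈ infPart b := by
        rw [← hinf, infPart_stanleyBound]
        exact hk
      exact le_top.trans (ge_of_eq this)
  · rintro _ ⟨i, rfl⟩
    exact ⟨hC.mem_associatedMulticomplex_of_le le_rfl, hfacet i⟩

end IsMonomialPrimeChain

end Chain

/-! ### Multigraded filtrations of `S/I` and chains of ideals. -/

section Filtration

variable {K : Type*} [Field K] {n : ℕ}

theorem isMultihomogeneous_iff {d : Fin n → ℤ} {f : MvPolynomial (Fin n) K} :
    IsMultihomogeneous d f ↔ ∀ e ∈ f.support, ∀ k, (e k : ℤ) = d k := by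
  have hw : ∀ e : Fin n →₀ ℕ,
      Finsupp.weight (fun i : Fin n => (Pi.single i 1 : Fin n → ℤ)) e = fun k => (e k : ℤ) := by
    intro e
    funext k
    rw [Finsupp.weight_apply, Finsupp.sum_fintype _ _ (by simp), Finset.sum_apply,
      Finset.sum_eq_single k]
    · simp
    · intro i _ hik
      simp [Pi.single_eq_of_ne hik.symm]
    · simp
  simp only [IsMultihomogeneous, IsWeightedHomogeneous, hw, mem_support_iff, _root_.funext_iff]

theorem isMultihomogeneous_monomial {d : Fin n → ℤ} {e : Fin n →₀ ℕ} (h : ∀ k, (e k : ℤ) = d k)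
    (c : K) : IsMultihomogeneous d (monomial e c) :=
  isMultihomogeneous_iff.2 fun f hf k => by
    obtain rfl := Finset.mem_singleton.1 (support_monomial_subset hf)
    exact h k

theorem IsMultihomogeneous.eq_zero_or {d : Fin n → ℤ} {f : MvPolynomial (Fin n) K}
    (hf : IsMultihomogeneous d f) :
    f = 0 ∨ ∃ (e : Fin n →₀ ℕ) (c : K), c ≠ 0 ∧ f = monomial e c ∧ ∀ k, (e k : ℤ) = d k := by
  rw [isMultihomogeneous_iff] at hf
  by_cases h0 : f = 0
  · exact Or.inl h0
  · obtain ⟨e, he⟩ := support_nonempty.2 h0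
    refine Or.inr ⟨e, f.coeff e, mem_support_iff.1 he, ?_, hf e he⟩
    have : f.support = {e} := Finset.eq_singleton_iff_unique_mem.2
      ⟨he, fun g hg => Finsupp.ext fun k => by
        have := (hf g hg k).trans (hf e he k).symm
        exact_mod_cast this⟩
    conv_lhs => rw [f.as_sum, this, Finset.sum_singleton]

theorem monomial_mem_iff_of_ne_zero {I : Ideal (MvPolynomial (Fin n) K)} {e : Fin n →₀ ℕ} {c : K}
    (hc : c ≠ 0) (s : MvPolynomial (Fin n) K) :
    s * monomial e c ∈ I ↔ s * monomial e (1 : K) ∈ I := by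
  have h1 : s * monomial e c = MvPolynomial.C c * (s * monomial e (1 : K)) := by
    rw [mul_left_comm, C_mul_monomial, mul_one]
  have h2 : s * monomial e (1 : K) = MvPolynomial.C c⁻¹ * (s * monomial e c) := by
    rw [mul_left_comm, C_mul_monomial, inv_mul_cancel₀ hc]
  exact ⟨fun h => h2 ▸ I.mul_mem_left _ h, fun h => h1 ▸ I.mul_mem_left _ h⟩

theorem monomial_mem_iff {I : Ideal (MvPolynomial (Fin n) K)} {e : Fin n →₀ ℕ} {c : K}
    (hc : c ≠ 0) : monomial e c ∈ I ↔ monomial e (1 : K) ∈ I := by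
  simpa only [one_mul] using monomial_mem_iff_of_ne_zero (e := e) hc (1 : MvPolynomial (Fin n) K)

/-- The preimage in `S` of a submodule of `S/I`. -/
noncomputable abbrev preimageIdeal (I : Ideal (MvPolynomial (Fin n) K))
    (M : Submodule (MvPolynomial (Fin n) K) (MvPolynomial (Fin n) K ⧸ I)) :
    Ideal (MvPolynomial (Fin n) K) :=
  M.comap (Algebra.linearMap (MvPolynomial (Fin n) K) (MvPolynomial (Fin n) K ⧸ I))

variable {I : Ideal (MvPolynomial (Fin n) K)}
  {M M' : Submodule (MvPolynomial (Fin n) K) (MvPolynomial (Fin n) K ⧸ I)}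

theorem mem_preimageIdeal {f : MvPolynomial (Fin n) K} :
    f ∈ preimageIdeal I M ↔ Ideal.Quotient.mk I f ∈ M := Iff.rfl

theorem le_preimageIdeal : I ≤ preimageIdeal I M := fun f hf => by
  rw [mem_preimageIdeal, Ideal.Quotient.eq_zero_iff_mem.2 hf]
  exact M.zero_mem

theorem linearMap_mk_surjective : Function.Surjective
    (Algebra.linearMap (MvPolynomial (Fin n) K) (MvPolynomial (Fin n) K ⧸ I)) :=
  Ideal.Quotient.mk_surjective

theorem preimageIdeal_le_iff : preimageIdeal I M ≤ preimageIdeal I M' ↔ M ≤ M' :=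
  Submodule.comap_le_comap_iff_of_surjective linearMap_mk_surjective

theorem preimageIdeal_bot : preimageIdeal I ⊥ = I := by
  ext f
  rw [mem_preimageIdeal, Submodule.mem_bot, Ideal.Quotient.eq_zero_iff_mem]

theorem preimageIdeal_injective : Function.Injective (preimageIdeal I) := fun _ _ h =>
  le_antisymm (preimageIdeal_le_iff.1 h.le) (preimageIdeal_le_iff.1 h.ge)

theorem preimageIdeal_map {D : Ideal (MvPolynomial (Fin n) K)} (h : I ≤ D) :
    preimageIdeal I (Submodule.map (Algebra.linearMap (MvPolynomial (Fin n) K)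
      (MvPolynomial (Fin n) K ⧸ I)) D) = D := by
  apply le_antisymm
  · rintro f ⟨g, hg, hgf⟩
    have : g - f ∈ I := Ideal.Quotient.eq.1 hgf
    have := D.sub_mem hg (h this)
    rwa [sub_sub_cancel] at this
  · exact Submodule.le_comap_map _ _

/-- A nonzero multihomogeneous polynomial is a scalar times a monomial, so homogeneous generators
pull back to monomials modulo `I`. -/
theorem isMultigradedSubmodule_iff (hI : IsMonomialIdeal I) :
    IsMultigradedSubmodule I M ↔ IsMonomialIdeal (preimageIdeal I M) := by
  constructor
  · intro h
    refine ⟨{e | monomial e (1 : K) ∈ preimageIdeal I M}, le_antisymm ?_ ?_⟩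
    · set D := Ideal.span ((fun e => monomial e (1 : K)) ''
        {e | monomial e (1 : K) ∈ preimageIdeal I M}) with hD
      have hID : I ≤ D := hI.le_of_monomial fun e he =>
        Ideal.subset_span ⟨e, le_preimageIdeal he, rfl⟩
      rw [← preimageIdeal_map hID, preimageIdeal_le_iff]
      conv_lhs => rw [h]
      rw [Submodule.span_le]
      rintro x ⟨hx, d, f, hf, rfl⟩
      rcases hf.eq_zero_or with rfl | ⟨e, c, hc, rfl, -⟩
      · rw [map_zero]
        exact Submodule.zero_mem _
      · refine ⟨_, ?_, rfl⟩
        exact (monomial_mem_iff hc).2 (Ideal.subset_span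
          ⟨e, (monomial_mem_iff (I := preimageIdeal I M) hc).1 hx, rfl⟩)
    · rw [Ideal.span_le]
      rintro _ ⟨e, he, rfl⟩
      exact he
  · intro h
    refine le_antisymm ?_ (Submodule.span_le.2 fun x hx => hx.1)
    rw [← preimageIdeal_le_iff]
    refine h.le_of_monomial fun e he => Submodule.subset_span ⟨he, fun k => (e k : ℤ), _,
      isMultihomogeneous_monomial (fun _ => rfl) 1, rfl⟩

theorem MultigradedIsoShift.exists_monomial {P : Ideal (MvPolynomial (Fin n) K)} {a : Fin n → ℤ}
    (hle : M' ≤ M) (hP : P ≠ ⊤) (h : MultigradedIsoShift I M' M P a) :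
    ∃ e : Fin n →₀ ℕ, (∀ k, (e k : ℤ) = a k) ∧
      preimageIdeal I M = preimageIdeal I M' ⊔ Ideal.span {monomial e (1 : K)} ∧
      (preimageIdeal I M').colon {monomial e (1 : K)} = P := by
  obtain ⟨φ, hφ⟩ := h
  -- The element `1` has degree `0 = a - a`, so its image has a representative `f` of degree `a`. It
  -- is nonzero because `P` is proper.
  obtain ⟨m, ⟨f, hf, hfm⟩, hm⟩ := (hφ a (Ideal.Quotient.mk P 1)).1
    ⟨1, isMultihomogeneous_monomial (e := 0) (by simp) 1, rfl⟩
  have hsmul : ∀ s, φ (Ideal.Quotient.mk P s) = (M'.submoduleOf M).mkQ (s • m) := by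
    intro s
    rw [map_smul, hm, ← map_smul]
    congr 1
    rw [← Ideal.Quotient.mk_eq_mk, ← Ideal.Quotient.mk_eq_mk, ← Submodule.Quotient.mk_smul,
      smul_eq_mul, mul_one]
  have hcolon : ∀ s, s * f ∈ preimageIdeal I M' ↔ s ∈ P := by
    intro s
    rw [← Ideal.Quotient.eq_zero_iff_mem (I := P), ← φ.map_eq_zero_iff, hsmul, Submodule.mkQ_apply,
      Submodule.Quotient.mk_eq_zero]
    change _ ↔ s • (m : MvPolynomial (Fin n) K ⧸ I) ∈ M'
    rw [← hfm]
    rfl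
  rcases hf.eq_zero_or with rfl | ⟨e, c, hc, rfl, he⟩
  · refine absurd (P.eq_top_iff_one.2 ((hcolon 1).1 ?_)) hP
    rw [mul_zero]
    exact Submodule.zero_mem _
  · simp only [monomial_mem_iff_of_ne_zero hc] at hcolon
    refine ⟨e, he, le_antisymm (fun g hg => ?_) (sup_le (preimageIdeal_le_iff.2 hle) ?_), ?_⟩
    · obtain ⟨s, hs⟩ := Ideal.Quotient.mk_surjective
        (φ.symm ((M'.submoduleOf M).mkQ ⟨Ideal.Quotient.mk I g, hg⟩))
      have h1 := hsmul s
      rw [hs, φ.apply_symm_apply, Submodule.mkQ_apply, Submodule.mkQ_apply,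
        Submodule.Quotient.eq] at h1
      have h2 : g - s * monomial e c ∈ preimageIdeal I M' := by
        change Ideal.Quotient.mk I g - s • (m : MvPolynomial (Fin n) K ⧸ I) ∈ M' at h1
        rw [← hfm] at h1
        exact h1
      rw [← sub_add_cancel g (s * monomial e c)]
      refine Submodule.add_mem_sup h2 ?_
      rw [monomial_mem_iff_of_ne_zero hc]
      exact Ideal.mul_mem_left _ _ (Ideal.mem_span_singleton_self _)
    · rw [Ideal.span_singleton_le_iff_mem, ← monomial_mem_iff hc, mem_preimageIdeal, hfm]
      exact m.2
    · ext s
      rw [Submodule.mem_colon_singleton, smul_eq_mul, hcolon]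

/-- The map `s ↦ s * u` from `S` to `M/M'` is surjective with kernel `P`, and it shifts degrees by
`a`. -/
theorem multigradedIsoShift_of_colon {P : Ideal (MvPolynomial (Fin n) K)} {a : Fin n → ℤ}
    {e : Fin n →₀ ℕ} (hM' : IsMonomialIdeal (preimageIdeal I M')) (he : ∀ k, (e k : ℤ) = a k)
    (hM : preimageIdeal I M = preimageIdeal I M' ⊔ Ideal.span {monomial e (1 : K)})
    (hP : (preimageIdeal I M').colon {monomial e (1 : K)} = P) :
    MultigradedIsoShift I M' M P a := by
  have hu : monomial e (1 : K) ∈ preimageIdeal I M :=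
    hM ▸ Ideal.mem_sup_right (Ideal.mem_span_singleton_self _)
  have hcolon : ∀ s, s * monomial e (1 : K) ∈ preimageIdeal I M' ↔ s ∈ P := fun s => by
    rw [← hP, Submodule.mem_colon_singleton, smul_eq_mul]
  let u : M := ⟨Ideal.Quotient.mk I (monomial e (1 : K)), hu⟩
  let ψ : MvPolynomial (Fin n) K →ₗ[MvPolynomial (Fin n) K] (M ⧸ M'.submoduleOf M) :=
    LinearMap.toSpanSingleton _ _ ((M'.submoduleOf M).mkQ u)
  have hψ : ∀ s, ψ s = (M'.submoduleOf M).mkQ (s • u) := fun s => by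
    rw [map_smul]
    rfl
  have hψ0 : ∀ s, ψ s = 0 ↔ s ∈ P := fun s => by
    rw [hψ, Submodule.mkQ_apply, Submodule.Quotient.mk_eq_zero, ← hcolon]
    rfl
  let θ : (MvPolynomial (Fin n) K ⧸ P) →ₗ[MvPolynomial (Fin n) K] (M ⧸ M'.submoduleOf M) :=
    Submodule.liftQ P ψ fun s hs => (hψ0 s).2 hs
  have hθ : ∀ s, θ (Ideal.Quotient.mk P s) = (M'.submoduleOf M).mkQ (s • u) := hψ
  have hinj : Function.Injective θ := by
    rw [injective_iff_map_eq_zero]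
    intro x hx
    obtain ⟨s, rfl⟩ := Ideal.Quotient.mk_surjective x
    exact Ideal.Quotient.eq_zero_iff_mem.2 ((hψ0 s).1 hx)
  have hsurj : Function.Surjective θ := by
    intro y
    obtain ⟨⟨x, hx⟩, rfl⟩ := Submodule.mkQ_surjective _ y
    obtain ⟨g, rfl⟩ := Ideal.Quotient.mk_surjective x
    have hg : g ∈ preimageIdeal I M := hx
    rw [hM] at hg
    obtain ⟨g', hg', v, hv, rfl⟩ := Submodule.mem_sup.1 hg
    obtain ⟨s, rfl⟩ := Ideal.mem_span_singleton'.1 hv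
    refine ⟨Ideal.Quotient.mk P s, ?_⟩
    rw [hθ, Submodule.mkQ_apply, Submodule.mkQ_apply, eq_comm, Submodule.Quotient.eq]
    change Ideal.Quotient.mk I (g' + s * monomial e (1 : K)) -
      Ideal.Quotient.mk I (s * monomial e (1 : K)) ∈ M'
    rw [← map_sub, add_sub_cancel_right]
    exact hg'
  refine ⟨LinearEquiv.ofBijective θ ⟨hinj, hsurj⟩, fun d x => ?_⟩
  change _ ↔ ∃ m : M, _ ∧ _ = θ x
  constructor
  · rintro ⟨f, hf, rfl⟩
    refine ⟨f • u, ⟨f * monomial e (1 : K), ?_, rfl⟩, (hθ f).symm⟩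
    rw [isMultihomogeneous_iff] at hf ⊢
    intro h hh k
    rw [mem_support_iff, coeff_mul_monomial'] at hh
    split_ifs at hh with hle
    · have h1 := hf (h - e) (mem_support_iff.2 (by simpa using hh)) k
      have h2 := hle k
      rw [Pi.sub_apply, ← he, Finsupp.tsub_apply] at h1
      omega
    · exact absurd rfl hh
  · rintro ⟨⟨_, hm⟩, ⟨g, hg, rfl⟩, hx⟩
    -- A representative in `M'` forces `x = 0`, which is homogeneous of every degree. This covers
    -- the degrees in which `g` is not a multiple of `u`.
    have hzero : g ∈ preimageIdeal I M' → QuotIsMultihomogeneous P (d - a) x := by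
      intro hg'
      refine ⟨0, isMultihomogeneous_iff.2 (by simp), ?_⟩
      rw [map_zero, eq_comm]
      refine (map_eq_zero_iff θ hinj).1 ?_
      rw [← hx, Submodule.mkQ_apply, Submodule.Quotient.mk_eq_zero]
      exact hg'
    rcases hg.eq_zero_or with rfl | ⟨h, c, hc, rfl, hh⟩
    · exact hzero (Submodule.zero_mem _)
    · have h1 : monomial h (1 : K) ∈ preimageIdeal I M := by
        rw [← monomial_mem_iff hc]
        exact hm
      rw [hM, monomial_mem_sup_span hM'] at h1
      rcases h1 with h1 | h1
      · apply hzero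
        exact (monomial_mem_iff hc).2 h1
      · refine ⟨monomial (h - e) c, isMultihomogeneous_monomial (fun k => ?_) c, hinj ?_⟩
        · have := h1 k
          have := hh k
          rw [Pi.sub_apply, ← he, Finsupp.tsub_apply]
          omega
        · rw [hθ, ← hx]
          congr 1
          apply Subtype.ext
          change Ideal.Quotient.mk I (monomial (h - e) c * monomial e (1 : K)) = _
          rw [monomial_mul, mul_one, tsub_add_cancel_of_le h1]

theorem isMultigradedPrimeFiltration_iff (hI : IsMonomialIdeal I) {r : ℕ}
    {M : Fin (r + 1) → Submodule (MvPolynomial (Fin n) K) (MvPolynomial (Fin n) K ⧸ I)}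
    {P : Fin r → Ideal (MvPolynomial (Fin n) K)} {a : Fin r → Fin n → ℤ} :
    IsMultigradedPrimeFiltration I M P a ↔
      ∃ e, IsMonomialPrimeChain I (fun i => preimageIdeal I (M i)) e P a := by
  constructor
  · intro h
    choose e he hsucc hcolon using fun i : Fin r => (h.factor i).exists_monomial
      (h.mono i.castSucc_le_succ) (h.prime i).ne_top
    exact ⟨e, fun i j hij => preimageIdeal_le_iff.2 (h.mono hij),
      by rw [h.zero, preimageIdeal_bot], by rw [h.last]; rfl,
      fun i => (isMultigradedSubmodule_iff hI).1 (h.graded i), he, hsucc, h.prime, hcolon⟩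
  · rintro ⟨e, h⟩
    exact ⟨fun i j hij => preimageIdeal_le_iff.1 (h.mono hij),
      preimageIdeal_injective (h.zero.trans preimageIdeal_bot.symm),
      preimageIdeal_injective h.last,
      fun i => (isMultigradedSubmodule_iff hI).2 (h.monomial i), h.prime, h.prime_monomial,
      fun i => multigradedIsoShift_of_colon (h.monomial _) (h.degree i) (h.succ i) (h.colon i)⟩

end Filtration

end MultigradedFiltration

/-! ### The main theorem. -/

open MultigradedFiltration in
theorem mainTheorem7 {K : Type*} [Field K] {n : ℕ} (I : Ideal (MvPolynomial (Fin n) K))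
    (hI : MultigradedFiltration.IsMonomialIdeal I) (r : ℕ)
    (P : Fin r → Ideal (MvPolynomial (Fin n) K)) (a : Fin r → Fin n → ℤ) :
    -- (a) ⟺ (b)
    ((∃ M, MultigradedFiltration.IsMultigradedPrimeFiltration I M P a) ↔
      ∃ C e, MultigradedFiltration.IsMonomialPrimeChain I C e P a) ∧
    -- the correspondence between filtrations and chains is `M_i = I_i / I`
    (∀ M : Fin (r + 1) → Submodule (MvPolynomial (Fin n) K) (MvPolynomial (Fin n) K ⧸ I),
      MultigradedFiltration.IsMultigradedPrimeFiltration I M P a ↔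
        ∃ e, MultigradedFiltration.IsMonomialPrimeChain I
          (fun i => (M i).comap (Algebra.linearMap (MvPolynomial (Fin n) K)
            (MvPolynomial (Fin n) K ⧸ I))) e P a) ∧
    ∀ C e, MultigradedFiltration.IsMonomialPrimeChain I C e P a →
      -- existence of the irreducible monomial ideals `J_j`
      (∃ J, MultigradedFiltration.IsIrreducibleDecomposition C J) ∧
      -- the pretty clean case: uniqueness of the set of the `J_j` and bijection with the facets
      (MultigradedFiltration.IsPrettyClean P →
        (∃! T : Set (Ideal (MvPolynomial (Fin n) K)),
          ∃ J, MultigradedFiltration.IsIrreducibleDecomposition C J ∧ Set.range J = T) ∧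
        ∀ J, MultigradedFiltration.IsIrreducibleDecomposition C J →
          Function.Injective J ∧
          Set.BijOn
            (fun b => MultigradedFiltration.multicomplexIdeal K
              (MultigradedFiltration.multicomplexGen {b}))
            (MultigradedFiltration.facets (MultigradedFiltration.associatedMulticomplex I))
            (Set.range J)) := by
  refine ⟨⟨?_, ?_⟩, fun M => isMultigradedPrimeFiltration_iff hI,
    fun C e hC => ⟨?_, fun hP => ⟨?_, ?_⟩⟩⟩
  · rintro ⟨M, hM⟩
    exact ⟨_, (isMultigradedPrimeFiltration_iff hI).1 hM⟩
  · rintro ⟨C, e, hC⟩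
    have hpre := funext fun i => preimageIdeal_map (hC.zero ▸ hC.mono (Fin.zero_le i))
    exact ⟨fun i => Submodule.map (Algebra.linearMap _ (MvPolynomial (Fin n) K ⧸ I)) (C i),
      (isMultigradedPrimeFiltration_iff hI).2 ⟨e, by rw [hpre]; exact hC⟩⟩
  · exact ⟨_, hC.isIrreducibleDecomposition_boxIdeal⟩
  · refine ⟨_, ⟨_, hC.isIrreducibleDecomposition_boxIdeal, rfl⟩, ?_⟩
    rintro _ ⟨J, hJ, rfl⟩
    rw [hC.eq_boxIdeal hJ]
  · intro J hJ
    rw [hC.eq_boxIdeal hJ, hC.facets_eq hP]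
    simp only [multicomplexIdeal_gen_singleton]
    refine ⟨boxIdeal_injective.comp hC.stanleyBound_injective, ?_⟩
    rw [Set.range_comp' (boxIdeal K)]
    exact boxIdeal_injective.injOn.bijOn_image
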